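/- Let $N_s$ users share a total bandwidth $B$. User $k$ chooses a feedback rate $r_k$ in a strategy set $\mathcal R_k\subseteq\mathbb R$; for a rate vector $\mathbf r=(r_1,\dots,r_{N_s})$ the downlink bandwidth is $B_{DL}(\mathbf r)=B-\beta\sum_{i} r_i$, and $\gamma_k(\mathbf r)$ denotes the SINR of user $k$. In the game NFC user $k$ has the utility $u_k(\mathbf r)=B_{DL}(\mathbf r)\log_2(1+\gamma_k(\mathbf r))$; in the game NFCP with price factor $\alpha\in\mathbb R$ it has the utility $u_k^c(\mathbf r)=u_k(\mathbf r)-\alpha r_k$. A (pure-strategy) Nash equilibrium is a vector $\mathbf r\in\prod_k\mathcal R_k$ such that no user can increase its own utility by changing only its own rate within its strategy set. **Theorem.** (1) For arbitrary functions $\gamma_k$, the NFCP has a Nash equilibrium provided that, for every $k$, (i) $\mathcal R_k$ is nonempty, convex and compact, and (ii) $u_k^c$ is continuous in $\mathbf r$ on $\prod_i\mathcal R_i$ and quasi-concave in $r_k\in\mathcal R_k$ for all fixed rates of the other users. In particular ($\alpha=0$) the same holds for the NFC with $u_k$ in place of $u_k^c$. (2) Let $\mathcal R_k=[0,r_k^{\max}]$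 with $r_k^{\max}\ge 0$, let $\beta\ge 0$, and suppose that $B_{DL}\ge 0$ on $\prod_i\mathcal R_i$. Suppose that each $\gamma_k$ is nonnegative and continuous on $\prod_i\mathcal R_i$ and nondecreasing in $r_k$, and that $\log_2(1+\gamma_k)$ is concave in $r_k$. Then, for every $\alpha$, each $u_k^c$ is concave in $r_k$, conditions (i) and (ii) hold, and the NFCP has a Nash equilibrium; likewise for the NFC. (3) Let $\gamma_k$ be the SINR of the regularized (MMSE) precoder: let $\mathbf H\in\mathbb C^{N_s\times N_t}$ be the channel matrix, with rows $\mathbf h_k^T$; let $\overline{\mathbf H}(\mathbf r)$ have the rows $\overline{\mathbf h}_k^T=\sqrt{1-2^{-r_k}}\,\mathbf h_k^T+\sqrt{2^{-r_k}}\,\mathbf n_k^T$, with fixed $\mathbf n_k\in\mathbb C^{N_t}$; let $\psi\in\mathbb R$, $\mathbf T=\overline{\mathbf H}^H(\overline{\mathbf H}\,\overline{\mathbf H}^H+\psi\mathbf I)^{-1}$, $\mathbf W=\mathbf T/\|\mathbf T\|_F$ with columns $\mathbf w_k$, and, with noise power $N_0>0$, $$\gamma_k=\frac{|\mathbf h_k^T\mathbf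 w_k|^2}{\big|\mathbf h_k^T\sum_{i\ne k}\mathbf w_i\big|^2+N_0}.$$ Let $\mathcal R_k=[0,r_k^{\max}]$ with $r_k^{\max}\ge0$, and suppose that the precoder is well defined (the inverse exists and $\mathbf T\neq 0$) for all $\mathbf r\in\prod_i\mathcal R_i$. Then condition (i) holds, each $\gamma_k$ is nonnegative and continuous on $\prod_i\mathcal R_i$, and so is continuous each $u_k^c$; hence, for every $\alpha$, the NFCP has a Nash equilibrium whenever each $u_k^c$ is quasi-concave in $r_k$. The same holds for the NFC with $u_k$. -/

import Mathlib

open scoped Matrix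

namespace FeedbackGame

/-- The set of all rate vectors: the product of the strategy sets `R k ⊆ ℝ`. -/
def strategySpace {Ns : ℕ} (R : Fin Ns → Set ℝ) : Set (Fin Ns → ℝ) :=
  Set.univ.pi R

/-- Strategy sets `[0, rmax k]`. -/
def rateInterval {Ns : ℕ} (rmax : Fin Ns → ℝ) (k : Fin Ns) : Set ℝ :=
  Set.Icc 0 (rmax k)

/-- Downlink bandwidth `B - β ∑ rᵢ`: what the uplink feedback leaves of the total bandwidth `B`. -/
noncomputable def downlinkBandwidth {Ns : ℕ} (B β : ℝ) (r : Fin Ns → ℝ) : ℝ :=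
  B - β * ∑ i, r i

/-- Utility of user `k` in the game without pricing: the throughput `B_DL log₂ (1 + γ k)`,
where `γ k r` is the SINR of user `k` at the rate vector `r`. -/
noncomputable def nfcUtility {Ns : ℕ} (B β : ℝ) (γ : Fin Ns → (Fin Ns → ℝ) → ℝ)
    (k : Fin Ns) (r : Fin Ns → ℝ) : ℝ :=
  downlinkBandwidth B β r * Real.logb 2 (1 + γ k r)

/-- Utility of user `k` in the game with linear pricing, with price factor `α`. -/
noncomputable def nfcpUtility {Ns : ℕ} (B β α : ℝ) (γ : Fin Ns → (Fin Ns → ℝ) → ℝ)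
    (k : Fin Ns) (r : Fin Ns → ℝ) : ℝ :=
  nfcUtility B β γ k r - α * r k

/-- Pure-strategy Nash equilibrium of the game with strategy sets `R` and utilities `u`. -/
def IsNashEquilibrium {Ns : ℕ} (R : Fin Ns → Set ℝ) (u : Fin Ns → (Fin Ns → ℝ) → ℝ)
    (r : Fin Ns → ℝ) : Prop :=
  r ∈ strategySpace R ∧
    ∀ k, ∀ x ∈ R k, u k (Function.update r k x) ≤ u k r

/-- First condition: every strategy set is nonempty, convex and compact. -/
def StrategySetsAdmissible {Ns : ℕ} (R : Fin Ns → Set ℝ) : Prop :=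
  ∀ k, (R k).Nonempty ∧ Convex ℝ (R k) ∧ IsCompact (R k)

/-- First half of the second condition: every utility is continuous in the rate vector. -/
def UtilitiesContinuous {Ns : ℕ} (R : Fin Ns → Set ℝ) (u : Fin Ns → (Fin Ns → ℝ) → ℝ) : Prop :=
  ∀ k, ContinuousOn (u k) (strategySpace R)

/-- Second half of the second condition: every utility is quasi-concave in the player's own rate,
for all rates of the other players. -/
def UtilitiesQuasiconcave {Ns : ℕ} (R : Fin Ns → Set ℝ) (u : Fin Ns → (Fin Ns → ℝ) → ℝ) : Prop :=
  ∀ k, ∀ r ∈ strategySpace R, QuasiconcaveOn ℝ (R k) (fun x => u k (Function.update r k x))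

/-- Every utility is concave in the player's own rate. -/
def UtilitiesConcave {Ns : ℕ} (R : Fin Ns → Set ℝ) (u : Fin Ns → (Fin Ns → ℝ) → ℝ) : Prop :=
  ∀ k, ∀ r ∈ strategySpace R, ConcaveOn ℝ (R k) (fun x => u k (Function.update r k x))

/-- Both conditions of the existence theorem. -/
def EquilibriumConditions {Ns : ℕ} (R : Fin Ns → Set ℝ)
    (u : Fin Ns → (Fin Ns → ℝ) → ℝ) : Prop :=
  StrategySetsAdmissible R ∧ UtilitiesContinuous R u ∧ UtilitiesQuasiconcave R u

/-- The normalized quantized channel matrix: row `k` is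
`√(1 - 2^(-r k)) h_k + √(2^(-r k)) n_k`, where `h_k` is row `k` of the channel matrix `H` and
`n_k` is row `k` of the realization `Nq` of the quantization noise. -/
noncomputable def quantizedChannel {Ns Nt : ℕ} (H Nq : Matrix (Fin Ns) (Fin Nt) ℂ)
    (r : Fin Ns → ℝ) : Matrix (Fin Ns) (Fin Nt) ℂ :=
  Matrix.of fun k j =>
    (Real.sqrt (1 - (2 : ℝ) ^ (-r k)) : ℂ) * H k j + (Real.sqrt ((2 : ℝ) ^ (-r k)) : ℂ) * Nq k j

/-- The regularized Gram matrix `A Aᴴ + ψ I`. -/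
noncomputable def regularizedGram {Ns Nt : ℕ} (ψ : ℝ) (A : Matrix (Fin Ns) (Fin Nt) ℂ) :
    Matrix (Fin Ns) (Fin Ns) ℂ :=
  A * Aᴴ + (ψ : ℂ) • (1 : Matrix (Fin Ns) (Fin Ns) ℂ)

/-- The unnormalized precoder `T = Aᴴ (A Aᴴ + ψ I)⁻¹`. -/
noncomputable def unnormalizedPrecoder {Ns Nt : ℕ} (ψ : ℝ) (A : Matrix (Fin Ns) (Fin Nt) ℂ) :
    Matrix (Fin Nt) (Fin Ns) ℂ :=
  Aᴴ * (regularizedGram ψ A)⁻¹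

/-- The precoder `W = K T`, with `K = ‖T‖⁻¹` (Frobenius norm: unit transmit power). -/
noncomputable def mmsePrecoder {Ns Nt : ℕ} (ψ : ℝ) (A : Matrix (Fin Ns) (Fin Nt) ℂ) :
    Matrix (Fin Nt) (Fin Ns) ℂ :=
  ((Real.sqrt (∑ j, ∑ i, ‖unnormalizedPrecoder ψ A j i‖ ^ 2))⁻¹ : ℂ) • unnormalizedPrecoder ψ A

/-- SINR of user `k` for channel matrix `H` (rows `h_kᵀ`), precoder `W` (columns `w_k`) and noise
power `N0`: `|h_kᵀ w_k|² / (|h_kᵀ ∑_{i ≠ k} w_i|² + N0)`. -/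
noncomputable def sinr {Ns Nt : ℕ} (N0 : ℝ) (H : Matrix (Fin Ns) (Fin Nt) ℂ)
    (W : Matrix (Fin Nt) (Fin Ns) ℂ) (k : Fin Ns) : ℝ :=
  ‖∑ j, H k j * W j k‖ ^ 2 / (‖∑ j, H k j * ∑ i ∈ Finset.univ.erase k, W j i‖ ^ 2 + N0)

/-- SINR of user `k`, as a function of the rate vector, when the precoder is computed from the
quantized channel. -/
noncomputable def mmseSinr {Ns Nt : ℕ} (N0 ψ : ℝ) (H Nq : Matrix (Fin Ns) (Fin Nt) ℂ)
    (k : Fin Ns) (r : Fin Ns → ℝ) : ℝ :=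
  sinr N0 H (mmsePrecoder ψ (quantizedChannel H Nq r)) k

end FeedbackGame

open FeedbackGame

/-! All three parts rest on `exists_isNashEquilibrium`. Since strategy sets are compact intervals,
no general fixed-point theorem for correspondences is needed. Let `A k` be the set of rate vectors
`r` at which user `k` has some best response `≥ r k`, and `C k` the same with `≤`. Both are closed,
by compactness and continuity of the utilities; they cover the box, and each contains the
appropriate face. Poincaré–Miranda gives a point `r` in all of them, so each `r k` lies between two
best responses; quasi-concavity makes the set of maximizers convex, so `r k` is itself a best
response.

Poincaré–Miranda follows from Kuhn's cubical Sperner lemma, proved by a cohomological count modulo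
2. Each coordinate carries a 0/1 label `s i`, prescribed on the two faces normal to that coordinate.
The sum over all simplices of `δ s₀ ∪ … ∪ δ s_N` is unaffected by replacing one label by another
with the same face values, because the difference is exact with a primitive vanishing on the
boundary. For one explicit labeling the sum is 1, so some simplex always contributes.

In the model, the conditions come from concavity of a product of nonnegative concave factors varying
in opposite directions; for the MMSE precoder, continuity comes from the adjugate formula and
nonvanishing denominators. -/

namespace FeedbackGame

open Filter Topology

/-! ### Cup products of coboundaries modulo 2. -/

section Cochains

variable {V : Type*}

/-- The sequence `v` with its `i`-th term deleted. -/
def deleteTerm (i : ℕ) (v : ℕ → V) (m : ℕ) : V := if m < i then v m else v (m + 1)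

/-- The cup product `δ s₀ ∪ … ∪ δ sₘ₋₁` modulo `2`, evaluated on the simplex `v₀, …, vₘ`. -/
def cupCoboundary (m : ℕ) (s : ℕ → V → ZMod 2) (v : ℕ → V) : ZMod 2 :=
  ∏ i ∈ Finset.range m, (s i (v (i + 1)) + s i (v i))

/-- The cup product `δ s₀ ∪ … ∪ δ sₖ₋₁ ∪ d ∪ δ sₖ₊₁ ∪ … ∪ δ sₖ₊ₘ` modulo `2`, evaluated on the
simplex `v₀, …, vₖ₊ₘ`. -/
def cupPrimitive (k m : ℕ) (s : ℕ → V → ZMod 2) (d : V → ZMod 2) (v : ℕ → V) : ZMod 2 :=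
  (∏ i ∈ Finset.range k, (s i (v (i + 1)) + s i (v i))) * (d (v k) *
    ∏ i ∈ Finset.range m, (s (k + 1 + i) (v (k + i + 1)) + s (k + 1 + i) (v (k + i))))

theorem deleteTerm_succ_zero (i : ℕ) (v : ℕ → V) : deleteTerm (i + 1) v 0 = v 0 := by
  simp [deleteTerm]

theorem deleteTerm_zero (v : ℕ → V) (m : ℕ) : deleteTerm 0 v m = v (m + 1) := by
  simp [deleteTerm]

theorem deleteTerm_succ_succ (i : ℕ) (v : ℕ → V) (m : ℕ) :
    deleteTerm (i + 1) v (m + 1) = deleteTerm i (fun l => v (l + 1)) m := by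
  simp [deleteTerm]

theorem cupCoboundary_succ (m : ℕ) (s : ℕ → V → ZMod 2) (v : ℕ → V) :
    cupCoboundary (m + 1) s v = (s 0 (v 1) + s 0 (v 0)) *
      cupCoboundary m (fun i => s (i + 1)) (fun i => v (i + 1)) := by
  rw [cupCoboundary, Finset.prod_range_succ', mul_comm]; rfl

theorem cupPrimitive_zero (m : ℕ) (s : ℕ → V → ZMod 2) (d : V → ZMod 2) (v : ℕ → V) :
    cupPrimitive 0 m s d v = d (v 0) * cupCoboundary m (fun i => s (i + 1)) v := by
  simp [cupPrimitive, cupCoboundary, add_comm 1]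

theorem cupPrimitive_succ (k m : ℕ) (s : ℕ → V → ZMod 2) (d : V → ZMod 2) (v : ℕ → V) :
    cupPrimitive (k + 1) m s d v = (s 0 (v 1) + s 0 (v 0)) *
      cupPrimitive k m (fun i => s (i + 1)) d (fun i => v (i + 1)) := by
  rw [cupPrimitive, Finset.prod_range_succ', cupPrimitive]
  simp only [show ∀ i, k + 1 + i = k + i + 1 from fun i => by ring,
    show ∀ i, k + 1 + 1 + i = k + i + 1 + 1 from fun i => by ring, zero_add]
  ring

theorem cupPrimitive_congr {k m : ℕ} {s : ℕ → V → ZMod 2} {d : V → ZMod 2} {v w : ℕ → V}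
    (h : ∀ i ≤ k + m, v i = w i) : cupPrimitive k m s d v = cupPrimitive k m s d w := by
  unfold cupPrimitive
  congr 1
  · refine Finset.prod_congr rfl fun i hi => ?_
    have := Finset.mem_range.1 hi
    rw [h i (by omega), h (i + 1) (by omega)]
  · rw [h k (by omega)]
    congr 1
    refine Finset.prod_congr rfl fun i hi => ?_
    have := Finset.mem_range.1 hi
    rw [h (k + i) (by omega), h (k + i + 1) (by omega)]

/-- A cup product of coboundaries is a cocycle. -/
theorem sum_cupCoboundary_deleteTerm (m : ℕ) (s : ℕ → V → ZMod 2) (v : ℕ → V) :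
    ∑ i ∈ Finset.range (m + 2), cupCoboundary m s (deleteTerm i v) = 0 := by
  induction m generalizing s v with
  | zero => simp [cupCoboundary]; rfl
  | succ m ih =>
    have h := ih (fun i => s (i + 1)) (fun l => v (l + 1))
    have e0 : deleteTerm 0 (fun l => v (l + 1)) = fun l => v (l + 1 + 1) :=
      funext (deleteTerm_zero _)
    rw [Finset.sum_range_succ', e0] at h
    rw [Finset.sum_range_succ', Finset.sum_range_succ']
    simp only [cupCoboundary_succ, deleteTerm_succ_zero, deleteTerm_succ_succ, deleteTerm_zero,
      ← Finset.mul_sum, zero_add] at h ⊢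
    have h2 : (2 : ZMod 2) = 0 := rfl
    -- Deleting `v 0` or `v 1` leaves the same tail from `v 2` on; the two leading factors add up to
    -- `s 0 (v 1) + s 0 (v 0)` because `s 0 (v 2)` occurs twice. This supplies the term of `h` where
    -- the first vertex is deleted.
    linear_combination (s 0 (v 1) + s 0 (v 0)) * h +
      (s 0 (v 2) * cupCoboundary m (fun i => s (i + 1))
        (fun l => v (l + 1 + 1))) * h2

/-- The Leibniz rule for `cupPrimitive`. -/
theorem sum_cupPrimitive_deleteTerm (k m : ℕ) (s : ℕ → V → ZMod 2) (d : V → ZMod 2)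
    (v : ℕ → V) :
    ∑ i ∈ Finset.range (k + m + 2), cupPrimitive k m s d (deleteTerm i v) =
      cupCoboundary (k + m + 1) (Function.update s k d) v := by
  have h2 : (2 : ZMod 2) = 0 := rfl
  induction k generalizing s v with
  | zero =>
    have h := sum_cupCoboundary_deleteTerm m (fun i => s (i + 1)) v
    rw [Finset.sum_range_succ'] at h
    rw [zero_add, Finset.sum_range_succ', cupCoboundary_succ]
    simp only [cupPrimitive_zero, deleteTerm_succ_zero, deleteTerm_zero,
      ← Finset.mul_sum, zero_add, Function.update_self, ne_eq, Nat.add_eq_zero_iff, one_ne_zero,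
      and_false, not_false_eq_true, Function.update_of_ne] at h ⊢
    have e : (deleteTerm 0 v) = fun i => v (i + 1) := funext (deleteTerm_zero v)
    rw [e] at h ⊢
    linear_combination d (v 0) * h - d (v 0) * cupCoboundary m (fun i => s (i + 1))
      (fun i => v (i + 1)) * h2
  | succ k ih =>
    have h := ih (fun i => s (i + 1)) (fun l => v (l + 1))
    have e0 : deleteTerm 0 (fun l => v (l + 1)) = fun l => v (l + 1 + 1) :=
      funext (deleteTerm_zero _)
    rw [Finset.sum_range_succ', e0] at h
    rw [show k + 1 + m + 2 = k + m + 1 + 1 + 1 by ring, show k + 1 + m + 1 = k + m + 1 + 1 by ring,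
      Finset.sum_range_succ', Finset.sum_range_succ', cupCoboundary_succ]
    have e : (fun i => Function.update s (k + 1) d (i + 1)) =
        Function.update (fun i => s (i + 1)) k d := by
      funext i
      by_cases hi : i = k
      · subst hi; simp
      · simp [hi]
    rw [e, ← h]
    simp only [cupPrimitive_succ, deleteTerm_succ_zero, deleteTerm_succ_succ, deleteTerm_zero,
      ← Finset.mul_sum, zero_add]
    rw [Function.update_of_ne (by omega)]
    linear_combination (s 0 (v 2) * cupPrimitive k m (fun i => s (i + 1)) d
        (fun l => v (l + 1 + 1))) * h2

/-- Only the `k`-th factor involves the updated label, and it is additive in it. -/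
theorem cupCoboundary_update_add {n k : ℕ} (hk : k < n) (s : ℕ → V → ZMod 2) (d e : V → ZMod 2)
    (v : ℕ → V) :
    cupCoboundary n (Function.update s k (d + e)) v =
      cupCoboundary n (Function.update s k d) v + cupCoboundary n (Function.update s k e) v := by
  have key : ∀ f : V → ZMod 2, cupCoboundary n (Function.update s k f) v =
      (f (v (k + 1)) + f (v k)) *
        ∏ i ∈ (Finset.range n).erase k, (s i (v (i + 1)) + s i (v i)) := by
    intro f
    rw [cupCoboundary, ← Finset.mul_prod_erase _ _ (Finset.mem_range.2 hk)]
    congr 1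
    · simp
    · refine Finset.prod_congr rfl fun i hi => ?_
      rw [Function.update_of_ne (Finset.ne_of_mem_erase hi)]
  rw [key, key, key]
  simp only [Pi.add_apply]
  ring

end Cochains

/-! ### The Freudenthal triangulation and the mod 2 count. -/

section Grid

variable {N : ℕ}

/-- The `m`-th vertex of the simplex of the Freudenthal triangulation with least vertex `q` whose
edges follow the coordinate directions in the order given by `τ`. -/
def gridVertex (q : Fin (N + 1) → ℕ) (τ : Equiv.Perm (Fin (N + 1))) (m : ℕ) :
    Fin (N + 1) → ℕ :=
  fun j => q j + if (τ j : ℕ) < m then 1 else 0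

/-- The simplices of the Freudenthal triangulation of the cube `[0, p]^(N + 1)`. -/
def gridSimplices (N p : ℕ) : Finset ((Fin (N + 1) → ℕ) × Equiv.Perm (Fin (N + 1))) :=
  (Fintype.piFinset fun _ => Finset.range p) ×ˢ Finset.univ

theorem mem_gridSimplices {p : ℕ} {a : (Fin (N + 1) → ℕ) × Equiv.Perm (Fin (N + 1))} :
    a ∈ gridSimplices N p ↔ ∀ j, a.1 j < p := by
  simp [gridSimplices]

/-- Each label `s i` is `0` on the face `x i = 0` of the cube and `1` on the face `x i = p`. -/
def IsFaceLabeling (N p : ℕ) (s : ℕ → (Fin (N + 1) → ℕ) → ZMod 2) : Prop :=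
  ∀ (i : Fin (N + 1)) (x : Fin (N + 1) → ℕ), (x i = 0 → s i x = 0) ∧ (x i = p → s i x = 1)

/-- On a face normal to direction `j` the label `s j` is constant, which kills the factor `δ s j`;
for `j = k` that factor is replaced by `d`, which vanishes there by assumption. -/
theorem cupPrimitive_eq_zero_of_face {p k m : ℕ} (hN : N = k + m)
    {s : ℕ → (Fin (N + 1) → ℕ) → ZMod 2} (hs : IsFaceLabeling N p s)
    {d : (Fin (N + 1) → ℕ) → ZMod 2}
    (hd : ∀ x : Fin (N + 1) → ℕ, x ⟨k, by omega⟩ = 0 ∨ x ⟨k, by omega⟩ = p → d x = 0)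
    {w : ℕ → Fin (N + 1) → ℕ} (j : Fin (N + 1))
    (hw : (∀ i ≤ N, w i j = 0) ∨ ∀ i ≤ N, w i j = p) :
    cupPrimitive k m s d w = 0 := by
  have const : ∀ i ≤ N, ∀ l ≤ N, s j (w i) + s j (w l) = 0 := by
    intro i hi l hl
    rcases hw with h | h
    · rw [(hs j _).1 (h i hi), (hs j _).1 (h l hl)]; rfl
    · rw [(hs j _).2 (h i hi), (hs j _).2 (h l hl)]; rfl
  have hj := j.2
  unfold cupPrimitive
  rcases lt_trichotomy (j : ℕ) k with h | h | h
  · rw [Finset.prod_eq_zero (Finset.mem_range.2 h) (const _ (by omega) _ (by omega)),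
      zero_mul]
  · have e : j = ⟨k, by omega⟩ := Fin.ext h
    rw [e] at hw
    rw [hd (w k) (hw.imp (fun h => h k (by omega)) (fun h => h k (by omega)))]
    simp
  · obtain ⟨i, hi⟩ := Nat.exists_eq_add_of_le (Nat.succ_le_of_lt h)
    have hi' : (j : ℕ) = k + 1 + i := hi
    have him : i < m := by omega
    have := const (k + i + 1) (by omega) (k + i) (by omega)
    rw [hi'] at this
    rw [Finset.prod_eq_zero (i := i) (Finset.mem_range.2 him) this]
    simp

/-- Exchanging the directions in positions `i` and `i + 1` changes only vertex `i + 1`, so the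
simplices pair off along the face opposite it and cancel modulo 2. -/
theorem sum_deleteTerm_interior {p k m i : ℕ} (hN : N = k + m) (hi : i < N)
    (s : ℕ → (Fin (N + 1) → ℕ) → ZMod 2) (d : (Fin (N + 1) → ℕ) → ZMod 2) :
    ∑ a ∈ gridSimplices N p, cupPrimitive k m s d (deleteTerm (i + 1) (gridVertex a.1 a.2)) =
      0 := by
  have two : ∀ a : ZMod 2, a + a = 0 := by decide
  let c : Equiv.Perm (Fin (N + 1)) := Equiv.swap ⟨i, by omega⟩ ⟨i + 1, by omega⟩
  have hc : ∀ t : Fin (N + 1), ∀ l, l ≠ i + 1 → ((c t : ℕ) < l ↔ (t : ℕ) < l) := by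
    intro t l hl
    simp only [c, Equiv.swap_apply_def]
    split_ifs with h1 h2
    · subst h1; simp; omega
    · subst h2; simp; omega
    · rfl
  refine Finset.sum_involution (fun a _ => (a.1, a.2.trans c)) ?_ ?_ ?_ ?_
  · intro a ha
    rw [cupPrimitive_congr (w := deleteTerm (i + 1) (gridVertex a.1 (a.2.trans c))), two]
    intro l _
    have : ∀ r, r ≠ i + 1 → gridVertex a.1 a.2 r = gridVertex a.1 (a.2.trans c) r := by
      intro r hr
      funext j
      simp only [gridVertex, Equiv.trans_apply, hc _ _ hr]
    unfold deleteTerm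
    split_ifs with h
    · exact this _ (by omega)
    · exact this _ (by omega)
  · intro a ha _ h
    have h1 := congrArg (fun b => (b.2 (a.2.symm ⟨i, by omega⟩) : ℕ)) h
    simp [c] at h1
  · intro a ha
    simpa [mem_gridSimplices] using ha
  · intro a ha
    ext j
    · rfl
    · simp [c]

/-- The face opposite the first vertex of one simplex is opposite the last vertex of the next one,
obtained by stepping along the first direction and moving that direction to the end. Faces without
such a neighbour lie on the boundary of the cube and contribute zero. -/
theorem sum_deleteTerm_ends {p k m : ℕ} (hN : N = k + m)
    {s : ℕ → (Fin (N + 1) → ℕ) → ZMod 2} (hs : IsFaceLabeling N p s)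
    {d : (Fin (N + 1) → ℕ) → ZMod 2}
    (hd : ∀ x : Fin (N + 1) → ℕ, x ⟨k, by omega⟩ = 0 ∨ x ⟨k, by omega⟩ = p → d x = 0) :
    ∑ a ∈ gridSimplices N p, cupPrimitive k m s d (deleteTerm 0 (gridVertex a.1 a.2)) =
      ∑ a ∈ gridSimplices N p,
        cupPrimitive k m s d (deleteTerm (N + 1) (gridVertex a.1 a.2)) := by
  let ρ : Equiv.Perm (Fin (N + 1)) := finRotate (N + 1)
  have hρ0 : ∀ t, ρ.symm t = Fin.last N ↔ t = 0 := by
    intro t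
    rw [Equiv.symm_apply_eq]
    simp [ρ]
  have hρ : ∀ t, t ≠ 0 → (ρ.symm t : ℕ) + 1 = t := by
    intro t ht
    have h1 : ρ.symm t ≠ Fin.last N := fun h => ht ((hρ0 t).1 h)
    have h2 := coe_finRotate_of_ne_last h1
    rw [← h2]
    simp [ρ]
  have vert : ∀ (q : Fin (N + 1) → ℕ) (τ : Equiv.Perm (Fin (N + 1))), ∀ l ≤ N,
      gridVertex (Function.update q (τ.symm 0) (q (τ.symm 0) + 1)) (τ.trans ρ.symm) l =
        gridVertex q τ (l + 1) := by
    intro q τ l hl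
    funext j
    by_cases hj : j = τ.symm 0
    · subst hj
      have := (hρ0 0).2 rfl
      simp [gridVertex, this]
      omega
    · have h0 : τ j ≠ 0 := fun h => hj (by rw [← h]; simp)
      have := hρ _ h0
      simp only [gridVertex, Function.update_of_ne hj, Equiv.trans_apply]
      have hlt : (ρ.symm (τ j) : ℕ) < l ↔ (τ j : ℕ) < l + 1 := by omega
      simp only [hlt]
  -- The shift may leave the cube, so only nonzero terms are matched: leaving through `x j = p`, or
  -- backwards through `x j = 0`, forces the term to vanish.
  refine Finset.sum_bij_ne_zero
    (fun a _ _ => (Function.update a.1 (a.2.symm 0) (a.1 (a.2.symm 0) + 1), a.2.trans ρ.symm))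
    ?_ ?_ ?_ ?_
  · rintro ⟨q, τ⟩ ha hne
    rw [mem_gridSimplices] at ha ⊢
    intro j
    by_cases hj : j = τ.symm 0
    · subst hj
      simp only [Function.update_self]
      refine lt_of_le_of_ne (ha _) fun h => hne ?_
      refine cupPrimitive_eq_zero_of_face hN hs hd (τ.symm 0) (Or.inr fun i _ => ?_)
      simpa [deleteTerm, gridVertex] using h
    · simpa [Function.update_of_ne hj] using ha j
  · rintro ⟨q, τ⟩ - - ⟨q', τ'⟩ - - h
    simp only [Prod.mk.injEq] at h
    have hτ : τ = τ' := by
      ext j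
      have := congrArg (fun e : Equiv.Perm _ => ρ (e j)) h.2
      simpa using congrArg Fin.val this
    subst hτ
    have hq : q = q' := by
      funext j
      have := congrFun h.1 j
      by_cases hj : j = τ.symm 0
      · subst hj; simpa using this
      · simpa [Function.update_of_ne hj] using this
    rw [hq]
  · rintro ⟨q, τ⟩ ha hne
    rw [mem_gridSimplices] at ha
    set j₀ := τ.symm (Fin.last N) with hj₀
    have hpos : q j₀ ≠ 0 := by
      intro h
      refine hne (cupPrimitive_eq_zero_of_face hN hs hd j₀ (Or.inl fun i hi => ?_))
      have : ¬ (τ j₀ : ℕ) < i := by simp [hj₀]; omega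
      simp [deleteTerm, gridVertex, show i < N + 1 by omega, h, this]
    have h0 : (τ.trans ρ).symm 0 = j₀ := by
      rw [Equiv.symm_trans_apply, (hρ0 0).2 rfl]
    have heq : ((Function.update (Function.update q j₀ (q j₀ - 1)) ((τ.trans ρ).symm 0)
        (Function.update q j₀ (q j₀ - 1) ((τ.trans ρ).symm 0) + 1),
        (τ.trans ρ).trans ρ.symm) : (Fin (N + 1) → ℕ) × Equiv.Perm (Fin (N + 1))) = (q, τ) := by
      rw [h0]
      ext j
      · by_cases hj : j = j₀
        · subst hj; simp; omega
        · simp [Function.update_of_ne hj]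
      · simp
    have hmem : ((Function.update q j₀ (q j₀ - 1), τ.trans ρ) :
        (Fin (N + 1) → ℕ) × Equiv.Perm (Fin (N + 1))) ∈ gridSimplices N p := by
      rw [mem_gridSimplices]
      intro j
      by_cases hj : j = j₀
      · subst hj
        have := ha j₀
        simp at this ⊢
        omega
      · simpa [Function.update_of_ne hj] using ha j
    refine ⟨_, hmem, ?_, heq⟩
    intro h
    refine hne ?_
    rw [← h]
    refine cupPrimitive_congr fun l hl => ?_
    have := vert (Function.update q j₀ (q j₀ - 1)) (τ.trans ρ) l (by omega)
    rw [deleteTerm_zero, ← this, deleteTerm, if_pos (by omega)]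
    rw [Prod.ext_iff] at heq
    dsimp only at heq ⊢
    rw [heq.1, heq.2]
  · rintro ⟨q, τ⟩ ha hne
    refine cupPrimitive_congr fun l hl => ?_
    dsimp only
    rw [deleteTerm_zero, deleteTerm, if_pos (by omega), vert q τ l (by omega)]

/-- Stokes' theorem: the summand is the coboundary of `cupPrimitive`, whose interior faces cancel in
pairs and which vanishes on the boundary. -/
theorem sum_cupCoboundary_update_eq_zero {p k : ℕ} (hk : k < N + 1)
    {s : ℕ → (Fin (N + 1) → ℕ) → ZMod 2} (hs : IsFaceLabeling N p s)
    {d : (Fin (N + 1) → ℕ) → ZMod 2}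
    (hd : ∀ x : Fin (N + 1) → ℕ, x ⟨k, hk⟩ = 0 ∨ x ⟨k, hk⟩ = p → d x = 0) :
    ∑ a ∈ gridSimplices N p,
      cupCoboundary (N + 1) (Function.update s k d) (gridVertex a.1 a.2) = 0 := by
  have two : ∀ a : ZMod 2, a + a = 0 := by decide
  obtain ⟨m, hm⟩ := Nat.exists_eq_add_of_le (Nat.lt_succ_iff.1 hk)
  have e : ∀ a ∈ gridSimplices N p,
      cupCoboundary (N + 1) (Function.update s k d) (gridVertex a.1 a.2) =
        ∑ i ∈ Finset.range (N + 2), cupPrimitive k m s d (deleteTerm i (gridVertex a.1 a.2)) := by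
    intro a _
    have := sum_cupPrimitive_deleteTerm k m s d (gridVertex a.1 a.2)
    rw [← hm] at this
    exact this.symm
  rw [Finset.sum_congr rfl e, Finset.sum_comm, Finset.sum_range_succ, Finset.sum_range_succ',
    Finset.sum_eq_zero, zero_add, sum_deleteTerm_ends hm hs hd, two]
  intro i hi
  exact sum_deleteTerm_interior hm (Finset.mem_range.1 hi) s d

/-- The labeling that is `0` exactly on the faces `x i = 0`. -/
def referenceLabel (N : ℕ) (i : ℕ) (x : Fin (N + 1) → ℕ) : ZMod 2 :=
  if h : i < N + 1 then if x ⟨i, h⟩ = 0 then 0 else 1 else 0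

theorem isFaceLabeling_referenceLabel {p : ℕ} (hp : 0 < p) :
    IsFaceLabeling N p (referenceLabel N) := by
  intro i x
  have hi := i.2
  constructor
  · intro h
    simp [referenceLabel, h]
  · intro h
    rw [referenceLabel, dif_pos hi, Fin.eta, if_neg (by omega)]

theorem sum_cupCoboundary_eq_reference {p : ℕ} (hp : 0 < p)
    {s : ℕ → (Fin (N + 1) → ℕ) → ZMod 2} (hs : IsFaceLabeling N p s) :
    ∑ a ∈ gridSimplices N p, cupCoboundary (N + 1) s (gridVertex a.1 a.2) =
      ∑ a ∈ gridSimplices N p,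
        cupCoboundary (N + 1) (referenceLabel N) (gridVertex a.1 a.2) := by
  -- The labels are exchanged one at a time: in `h k` the first `k` are already the reference ones.
  -- Each exchange adds `s k + referenceLabel N k`, which is zero on both faces normal to direction
  -- `k`.
  have two : ∀ a b : ZMod 2, a + (a + b) = b := by decide
  have hr := isFaceLabeling_referenceLabel (N := N) hp
  let h : ℕ → ℕ → (Fin (N + 1) → ℕ) → ZMod 2 := fun k i => if i < k then referenceLabel N i else s i
  have hh : ∀ k, IsFaceLabeling N p (h k) := by
    intro k i x
    by_cases hik : (i : ℕ) < k
    · simpa [h, hik] using hr i x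
    · simpa [h, hik] using hs i x
  have step : ∀ k, k ≤ N + 1 →
      ∑ a ∈ gridSimplices N p, cupCoboundary (N + 1) s (gridVertex a.1 a.2) =
      ∑ a ∈ gridSimplices N p, cupCoboundary (N + 1) (h k) (gridVertex a.1 a.2) := by
    intro k
    induction k with
    | zero => intro _; simp [h]
    | succ k ih =>
      intro hk
      rw [ih (by omega)]
      have hk' : k < N + 1 := hk
      have e1 : h (k + 1) = Function.update (h k) k (s k + (s k + referenceLabel N k)) := by
        funext i
        by_cases hi : i = k
        · subst hi
          funext x
          simp [h, two]
        · rw [Function.update_of_ne hi]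
          have : i < k + 1 ↔ i < k := by omega
          simp [h, this]
      have e2 : Function.update (h k) k (s k) = h k := by
        rw [Function.update_eq_self_iff]
        exact (if_neg (lt_irrefl k)).symm
      rw [e1, Finset.sum_congr rfl fun a _ => cupCoboundary_update_add hk' (h k) _ _ _, e2,
        Finset.sum_add_distrib, sum_cupCoboundary_update_eq_zero hk' (hh k), add_zero]
      rintro x (hx | hx)
      · have a1 := (hs ⟨k, hk'⟩ x).1 hx
        have a2 := (hr ⟨k, hk'⟩ x).1 hx
        simp only at a1 a2
        simp [a1, a2]
      · have a1 := (hs ⟨k, hk'⟩ x).2 hx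
        have a2 := (hr ⟨k, hk'⟩ x).2 hx
        simp only at a1 a2
        simp [a1, a2]
        rfl
  rw [step (N + 1) le_rfl]
  refine Finset.sum_congr rfl fun a _ => ?_
  refine Finset.prod_congr rfl fun i hi => ?_
  simp [h, Finset.mem_range.1 hi]

/-- The label `j` changes on the `j`-th edge only if that edge leaves `x j = 0` in direction `j`.
This for all `j` singles out the simplex at the origin with the identity order. -/
theorem sum_cupCoboundary_reference {p : ℕ} (hp : 0 < p) :
    ∑ a ∈ gridSimplices N p,
      cupCoboundary (N + 1) (referenceLabel N) (gridVertex a.1 a.2) = 1 := by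
  have key : ∀ (q : Fin (N + 1) → ℕ) (τ : Equiv.Perm (Fin (N + 1))) (j : Fin (N + 1)),
      referenceLabel N j (gridVertex q τ (j + 1)) + referenceLabel N j (gridVertex q τ j) =
        if q j = 0 ∧ τ j = j then 1 else 0 := by
    intro q τ j
    simp only [referenceLabel, j.2, dif_pos, Fin.eta, gridVertex, Fin.ext_iff]
    have hj := j.2
    by_cases hq : q j = 0
    · rcases lt_trichotomy (τ j : ℕ) j with h | h | h
      · simp [hq, h, h.ne, Nat.lt_succ_of_lt h]
        rfl
      · simp [hq, h]
      · simp [hq, h.ne', h.not_gt, show ¬ (τ j : ℕ) < j + 1 by omega]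
    · simp [hq]
      rfl
  rw [Finset.sum_eq_single ((fun _ => 0), 1)]
  · refine Finset.prod_eq_one fun i hi => ?_
    have := key (fun _ => 0) 1 ⟨i, Finset.mem_range.1 hi⟩
    simpa using this
  · rintro ⟨q, τ⟩ - hne
    by_contra h
    refine hne ?_
    have hj : ∀ j, q j = 0 ∧ τ j = j := by
      intro j
      by_contra hc
      refine h (Finset.prod_eq_zero (Finset.mem_range.2 j.2) ?_)
      rw [key, if_neg hc]
    ext j
    · exact (hj j).1
    · simp [(hj j).2]
  · intro h
    exact (h (mem_gridSimplices.2 fun _ => hp)).elim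

/-- Kuhn's cubical form of Sperner's lemma. -/
theorem exists_simplex_of_isFaceLabeling {p : ℕ} (hp : 0 < p)
    {s : ℕ → (Fin (N + 1) → ℕ) → ZMod 2} (hs : IsFaceLabeling N p s) :
    ∃ (q : Fin (N + 1) → ℕ) (τ : Equiv.Perm (Fin (N + 1))), (∀ j, q j < p) ∧
      ∀ i : Fin (N + 1), s i (gridVertex q τ (i + 1)) ≠ s i (gridVertex q τ i) := by
  have h := sum_cupCoboundary_eq_reference hp hs
  rw [sum_cupCoboundary_reference hp] at h
  obtain ⟨⟨q, τ⟩, ha, hne⟩ := Finset.exists_ne_zero_of_sum_ne_zero (h ▸ one_ne_zero)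
  refine ⟨q, τ, mem_gridSimplices.1 ha, fun i hi => hne ?_⟩
  refine Finset.prod_eq_zero (Finset.mem_range.2 i.2) ?_
  rw [hi]
  exact CharTwo.add_self_eq_zero _

end Grid

/-! ### From labelings to closed covers. -/

/-- The Poincaré–Miranda theorem for closed covers of a box. -/
theorem exists_mem_inter_of_closed_cover {n : ℕ} {a b : Fin n → ℝ} (hab : a ≤ b)
    {A C : Fin n → Set (Fin n → ℝ)} (hA : ∀ k, IsClosed (A k)) (hC : ∀ k, IsClosed (C k))
    (hcover : ∀ k, ∀ x ∈ Set.Icc a b, x ∈ A k ∨ x ∈ C k)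
    (hleft : ∀ k, ∀ x ∈ Set.Icc a b, x k = a k → x ∈ A k)
    (hright : ∀ k, ∀ x ∈ Set.Icc a b, x k = b k → x ∈ C k) :
    ∃ x ∈ Set.Icc a b, ∀ k, x ∈ A k ∧ x ∈ C k := by
  classical
  rcases n with _ | N
  · exact ⟨a, ⟨le_rfl, hab⟩, fun k => k.elim0⟩
  let pt : ℕ → (Fin (N + 1) → ℕ) → Fin (N + 1) → ℝ :=
    fun p x j => a j + (x j : ℝ) / p * (b j - a j)
  have hba : ∀ j, 0 ≤ b j - a j := fun j => sub_nonneg.2 (hab j)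
  have hpt : ∀ p x, 0 < p → (∀ j, x j ≤ p) → pt p x ∈ Set.Icc a b := by
    intro p x hp hx
    have hp' : (0 : ℝ) < p := Nat.cast_pos.2 hp
    refine ⟨fun j => ?_, fun j => ?_⟩
    · have := mul_nonneg (div_nonneg (Nat.cast_nonneg (α := ℝ) (x j)) hp'.le) (hba j)
      simp only [pt]
      linarith
    · have h1 : (x j : ℝ) / p ≤ 1 := (div_le_one hp').2 (Nat.cast_le.2 (hx j))
      have := mul_le_mul_of_nonneg_right h1 (hba j)
      simp only [pt]
      linarith
  have step : ∀ p : ℕ, ∃ z ∈ Set.Icc a b, ∀ k, ∃ y ∈ A k, ∃ y' ∈ C k,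
      dist y z ≤ dist a b / (p + 1) ∧ dist y' z ≤ dist a b / (p + 1) := by
    intro p
    -- Label 0 certifies membership in `A i`, label 1 in `C i`. The values on the two faces take
    -- precedence over the cover, as points there may lie in both sets. The mesh is `1 / (p + 1)` to
    -- avoid an empty grid.
    let s : ℕ → (Fin (N + 1) → ℕ) → ZMod 2 := fun i x =>
      if h : i < N + 1 then
        if x ⟨i, h⟩ = 0 ∨ (x ⟨i, h⟩ ≠ p + 1 ∧ pt (p + 1) x ∈ A ⟨i, h⟩) then 0 else 1
      else 0
    have hs : IsFaceLabeling N (p + 1) s := by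
      intro i x
      refine ⟨fun h => ?_, fun h => ?_⟩
      · simp only [s, i.2, dif_pos, Fin.eta, h, true_or, if_true]
      · simp only [s, i.2, dif_pos, Fin.eta, h]
        simp
    obtain ⟨q, τ, hq, hne⟩ := exists_simplex_of_isFaceLabeling p.succ_pos hs
    have hv : ∀ m, pt (p + 1) (gridVertex q τ m) ∈ Set.Icc a b := by
      intro m
      refine hpt _ _ p.succ_pos fun j => ?_
      have := hq j
      unfold gridVertex
      split_ifs <;> omega
    have hd : ∀ m, dist (pt (p + 1) (gridVertex q τ m)) (pt (p + 1) q) ≤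
        dist a b / (p + 1) := by
      intro m
      refine (dist_pi_le_iff (by positivity)).2 fun j => ?_
      have e : pt (p + 1) (gridVertex q τ m) j - pt (p + 1) q j =
          (if (τ j : ℕ) < m then 1 else 0) / (p + 1) * (b j - a j) := by
        simp only [pt, gridVertex]
        push_cast
        ring
      have h1 := dist_le_pi_dist a b j
      rw [Real.dist_eq, abs_sub_comm, abs_of_nonneg (hba j)] at h1
      rw [Real.dist_eq, e]
      split_ifs
      · rw [abs_of_nonneg (mul_nonneg (by positivity) (hba j)), one_div, div_eq_inv_mul]
        exact mul_le_mul_of_nonneg_left h1 (by positivity)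
      · simp only [zero_div, zero_mul, abs_zero]
        positivity
    have hzero : ∀ (k : Fin (N + 1)) (m : ℕ), s k (gridVertex q τ m) = 0 →
        pt (p + 1) (gridVertex q τ m) ∈ A k := by
      intro k m h
      simp only [s, k.2, dif_pos, Fin.eta] at h
      split_ifs at h with h'
      · rcases h' with h' | h'
        · exact hleft k _ (hv m) (by simp [pt, h'])
        · exact h'.2
      · exact absurd h one_ne_zero
    have hone : ∀ (k : Fin (N + 1)) (m : ℕ), s k (gridVertex q τ m) ≠ 0 →
        pt (p + 1) (gridVertex q τ m) ∈ C k := by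
      intro k m h
      simp only [s, k.2, dif_pos, Fin.eta] at h
      split_ifs at h with h'
      · exact absurd rfl h
      · push Not at h'
        by_cases hk : gridVertex q τ m k = p + 1
        · refine hright k _ (hv m) ?_
          have : ((p : ℝ) + 1) ≠ 0 := by positivity
          simp [pt, hk, div_self this]
        · exact (hcover k _ (hv m)).resolve_left (h'.2 hk)
    refine ⟨pt (p + 1) q, hpt _ _ p.succ_pos fun j => (hq j).le, fun k => ?_⟩
    by_cases h0 : s k (gridVertex q τ k) = 0
    · exact ⟨_, hzero k _ h0, _, hone k (k + 1) fun h => hne k (h.trans h0.symm), hd _, hd _⟩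
    · have h1 : s k (gridVertex q τ (k + 1)) = 0 := by
        have two : ∀ u w : ZMod 2, u ≠ w → w ≠ 0 → u = 0 := by decide
        exact two _ _ (hne k) h0
      exact ⟨_, hzero k _ h1, _, hone k _ h0, hd _, hd _⟩
  choose z hz y hyA y' hyC hy hy' using step
  -- One subsequence of base points serves all `k`: the points of `A k` and `C k` are within the
  -- mesh size of it, hence share its limit.
  obtain ⟨x, hx, φ, hφ, hlim⟩ := isCompact_Icc.tendsto_subseq hz
  have hsmall : Tendsto (fun p : ℕ => dist a b / ((φ p : ℝ) + 1)) atTop (𝓝 0) := by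
    have h := tendsto_const_div_atTop_nhds_zero_nat (dist a b)
    have h2 := (tendsto_add_atTop_iff_nat 1).2 h
    have h3 := h2.comp hφ.tendsto_atTop
    refine h3.congr fun p => ?_
    simp
  have near : ∀ w : ℕ → Fin (N + 1) → ℝ, (∀ p, dist (w p) (z p) ≤ dist a b / (p + 1)) →
      Tendsto (w ∘ φ) atTop (𝓝 x) := by
    intro w hw
    refine (tendsto_iff_of_dist ?_).2 hlim
    exact squeeze_zero (fun _ => dist_nonneg) (fun p => hw (φ p)) hsmall
  refine ⟨x, hx, fun k => ⟨?_, ?_⟩⟩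
  · exact (hA k).mem_of_tendsto (near (fun p => y p k) fun p => hy p k)
      (Eventually.of_forall fun p => hyA _ _)
  · exact (hC k).mem_of_tendsto (near (fun p => y' p k) fun p => hy' p k)
      (Eventually.of_forall fun p => hyC _ _)

/-! ### Best responses and existence of an equilibrium. -/

/-- `z` is a best response of user `k` to the rates of the other users in `r`. -/
def IsBestResponse {Ns : ℕ} (R : Fin Ns → Set ℝ) (u : Fin Ns → (Fin Ns → ℝ) → ℝ)
    (k : Fin Ns) (r : Fin Ns → ℝ) (z : ℝ) : Prop :=
  z ∈ R k ∧ ∀ t ∈ R k, u k (Function.update r k t) ≤ u k (Function.update r k z)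

variable {Ns : ℕ} {R : Fin Ns → Set ℝ} {u : Fin Ns → (Fin Ns → ℝ) → ℝ}

theorem update_mem_strategySpace {r : Fin Ns → ℝ} (hr : r ∈ strategySpace R) {k : Fin Ns} {t : ℝ}
    (ht : t ∈ R k) : Function.update r k t ∈ strategySpace R := by
  intro j _
  by_cases hj : j = k
  · subst hj; simpa using ht
  · simpa [Function.update_of_ne hj] using hr j trivial

theorem exists_isBestResponse (hR : StrategySetsAdmissible R) (hu : UtilitiesContinuous R u)
    (k : Fin Ns) {r : Fin Ns → ℝ} (hr : r ∈ strategySpace R) :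
    ∃ z, IsBestResponse R u k r z := by
  have hc : ContinuousOn (fun t => u k (Function.update r k t)) (R k) :=
    (hu k).comp (by fun_prop) fun t ht => update_mem_strategySpace hr ht
  obtain ⟨z, hz, hmax⟩ := (hR k).2.2.exists_isMaxOn (hR k).1 hc
  exact ⟨z, hz, fun t ht => hmax ht⟩

/-- The rate vectors to which some best response `z` of user `k` satisfies a closed condition form
a closed set. -/
theorem isClosed_setOf_isBestResponse (hR : StrategySetsAdmissible R)
    (hu : UtilitiesContinuous R u) (k : Fin Ns) {D : Set ((Fin Ns → ℝ) × ℝ)} (hD : IsClosed D) :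
    IsClosed {r | r ∈ strategySpace R ∧ ∃ z, IsBestResponse R u k r z ∧ (r, z) ∈ D} := by
  have hS : IsCompact (strategySpace R) := isCompact_univ_pi fun k => (hR k).2.2
  have hK : IsCompact (strategySpace R ×ˢ R k) := hS.prod (hR k).2.2
  have hT : IsClosed {p | p ∈ strategySpace R ×ˢ R k ∧ ∀ t ∈ R k,
      u k (Function.update p.1 k t) ≤ u k (Function.update p.1 k p.2)} := by
    have e : {p | p ∈ strategySpace R ×ˢ R k ∧ ∀ t ∈ R k,
        u k (Function.update p.1 k t) ≤ u k (Function.update p.1 k p.2)} =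
        (strategySpace R ×ˢ R k) ∩ ⋂ t ∈ R k, {p ∈ strategySpace R ×ˢ R k |
          u k (Function.update p.1 k t) ≤ u k (Function.update p.1 k p.2)} := by
      ext p
      simp only [Set.mem_ofPred_eq, Set.mem_inter_iff, Set.mem_iInter]
      exact ⟨fun h => ⟨h.1, fun t ht => ⟨h.1, h.2 t ht⟩⟩, fun h => ⟨h.1, fun t ht => (h.2 t ht).2⟩⟩
    rw [e]
    refine hK.isClosed.inter (isClosed_biInter fun t ht => hK.isClosed.isClosed_le ?_ ?_)
    · exact (hu k).comp (by fun_prop) fun p hp => update_mem_strategySpace hp.1 ht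
    · exact (hu k).comp (by fun_prop) fun p hp => update_mem_strategySpace hp.1 hp.2
  -- The graph of the best-response correspondence is compact, so its part in `D` has a closed
  -- projection.
  have hT' := (hK.of_isClosed_subset hT fun p hp => hp.1).inter_right hD
  convert (hT'.image continuous_fst).isClosed using 1
  ext r
  constructor
  · rintro ⟨hr, z, hz, hzD⟩
    exact ⟨(r, z), ⟨⟨⟨hr, hz.1⟩, hz.2⟩, hzD⟩, rfl⟩
  · rintro ⟨⟨r', z⟩, ⟨⟨⟨hr, hz⟩, hmax⟩, hzD⟩, rfl⟩
    exact ⟨hr, z, ⟨hz, hmax⟩, hzD⟩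

/-- The Debreu–Glicksberg–Fan theorem for one-dimensional strategy sets. -/
theorem exists_isNashEquilibrium (h : EquilibriumConditions R u) :
    ∃ r, IsNashEquilibrium R u r := by
  obtain ⟨hR, hu, hq⟩ := h
  have hIcc : ∀ k, R k = Set.Icc (sInf (R k)) (sSup (R k)) := fun k =>
    eq_Icc_of_connected_compact ⟨(hR k).1, (hR k).2.1.isPreconnected⟩ (hR k).2.2
  set a : Fin Ns → ℝ := fun k => sInf (R k) with ha
  set b : Fin Ns → ℝ := fun k => sSup (R k) with hb
  have hab : a ≤ b := fun k => by
    have := (hR k).1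
    rw [hIcc k] at this
    exact Set.nonempty_Icc.1 this
  have hS : strategySpace R = Set.Icc a b := by
    rw [← Set.pi_univ_Icc, strategySpace]
    exact congrArg _ (funext hIcc)
  have hle : ∀ k : Fin Ns, IsClosed {p : (Fin Ns → ℝ) × ℝ | p.1 k ≤ p.2} := fun k =>
    isClosed_le (by fun_prop) (by fun_prop)
  have hge : ∀ k : Fin Ns, IsClosed {p : (Fin Ns → ℝ) × ℝ | p.2 ≤ p.1 k} := fun k =>
    isClosed_le (by fun_prop) (by fun_prop)
  obtain ⟨r, hr, hsol⟩ := exists_mem_inter_of_closed_cover hab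
    (fun k => isClosed_setOf_isBestResponse hR hu k (hle k))
    (fun k => isClosed_setOf_isBestResponse hR hu k (hge k))
    (by
      intro k x hx
      rw [← hS] at hx
      obtain ⟨z, hz⟩ := exists_isBestResponse hR hu k hx
      exact (le_total (x k) z).imp (fun h => ⟨hx, z, hz, h⟩) fun h => ⟨hx, z, hz, h⟩)
    (by
      intro k x hx hxk
      rw [← hS] at hx
      obtain ⟨z, hz⟩ := exists_isBestResponse hR hu k hx
      refine ⟨hx, z, hz, ?_⟩
      have := hz.1
      rw [hIcc k] at this
      exact hxk.trans_le this.1)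
    (by
      intro k x hx hxk
      rw [← hS] at hx
      obtain ⟨z, hz⟩ := exists_isBestResponse hR hu k hx
      refine ⟨hx, z, hz, ?_⟩
      have := hz.1
      rw [hIcc k] at this
      exact this.2.trans_eq hxk.symm)
  rw [← hS] at hr
  refine ⟨r, hr, fun k t ht => ?_⟩
  obtain ⟨⟨-, z, hz, hrz⟩, -, z', hz', hrz'⟩ := hsol k
  -- The superlevel set at the value of the deviation `t` contains both best responses `z' ≤ r k ≤
  -- z`, hence `r k`.
  have hord := (hq k r hr (u k (Function.update r k t))).ordConnected
  have hmem := hord.out ⟨hz'.1, hz'.2 t ht⟩ ⟨hz.1, hz.2 t ht⟩ ⟨hrz', hrz⟩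
  simpa using hmem.2

/-! ### Continuity and concavity of the utilities. -/

section Model

variable {Ns : ℕ} {B β : ℝ} {γ : Fin Ns → (Fin Ns → ℝ) → ℝ} {rmax : Fin Ns → ℝ}

theorem nfcpUtility_zero (B β : ℝ) (γ : Fin Ns → (Fin Ns → ℝ) → ℝ) :
    nfcpUtility B β 0 γ = nfcUtility B β γ := by
  funext k r
  simp [nfcpUtility]

theorem strategySetsAdmissible_rateInterval (h : ∀ k, 0 ≤ rmax k) :
    StrategySetsAdmissible (rateInterval rmax) := fun k =>
  ⟨Set.nonempty_Icc.2 (h k), convex_Icc _ _, isCompact_Icc⟩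

theorem utilitiesContinuous_nfcpUtility {R : Fin Ns → Set ℝ} (α : ℝ)
    (hγ : ∀ k, ∀ r ∈ strategySpace R, 0 ≤ γ k r)
    (hc : ∀ k, ContinuousOn (γ k) (strategySpace R)) :
    UtilitiesContinuous R (nfcpUtility B β α γ) := by
  intro k
  have hlog : ContinuousOn (fun r => Real.log (1 + γ k r)) (strategySpace R) :=
    (continuousOn_const.add (hc k)).log fun r hr =>
      (add_pos_of_pos_of_nonneg one_pos (hγ k r hr)).ne'
  have hB : Continuous fun r : Fin Ns → ℝ => downlinkBandwidth B β r := by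
    unfold downlinkBandwidth
    fun_prop
  have hk : Continuous fun r : Fin Ns → ℝ => α * r k := by fun_prop
  exact (hB.continuousOn.mul (hlog.div_const _)).sub hk.continuousOn

theorem downlinkBandwidth_update (B β : ℝ) (r : Fin Ns → ℝ) (k : Fin Ns) (x : ℝ) :
    downlinkBandwidth B β (Function.update r k x) =
      (B - β * ∑ i ∈ Finset.univ.erase k, r i) - β * x := by
  rw [downlinkBandwidth, ← Finset.add_sum_erase _ _ (Finset.mem_univ k), Function.update_self,
    Finset.sum_congr rfl fun i hi => Function.update_of_ne (Finset.ne_of_mem_erase hi) x r]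
  ring

theorem concaveOn_const_sub_mul {s : Set ℝ} (hs : Convex ℝ s) (c β : ℝ) :
    ConcaveOn ℝ s fun x => c - β * x :=
  ⟨hs, fun x _ y _ p q _ _ hpq => by
    simp only [smul_eq_mul]
    exact le_of_eq (by linear_combination c * hpq)⟩

/-- In the own rate, bandwidth is affine and nonincreasing while the logarithm is concave and
nondecreasing, both nonnegative. The cross term `(f x - f y) * (g x - g y)` is then nonpositive,
which makes the product concave; the price is affine, so the sign of `α` is irrelevant. -/
theorem utilitiesConcave_nfcpUtility {R : Fin Ns → Set ℝ} (hR : ∀ k, Convex ℝ (R k)) (α : ℝ)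
    (hβ : 0 ≤ β) (hB : ∀ r ∈ strategySpace R, 0 ≤ downlinkBandwidth B β r)
    (hγ : ∀ k, ∀ r ∈ strategySpace R, 0 ≤ γ k r)
    (hmono : ∀ k, ∀ r ∈ strategySpace R,
      MonotoneOn (fun x => γ k (Function.update r k x)) (R k))
    (hconc : ∀ k, ∀ r ∈ strategySpace R,
      ConcaveOn ℝ (R k) (fun x => Real.logb 2 (1 + γ k (Function.update r k x)))) :
    UtilitiesConcave R (nfcpUtility B β α γ) := by
  intro k r hr
  have hmem : ∀ x ∈ R k, Function.update r k x ∈ strategySpace R := fun x hx =>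
    update_mem_strategySpace hr hx
  set c := B - β * ∑ i ∈ Finset.univ.erase k, r i
  have hprod := (concaveOn_const_sub_mul (hR k) c β).mul (hconc k r hr)
    (fun x hx => by
      have := hB _ (hmem x hx)
      rwa [downlinkBandwidth_update] at this)
    (fun x hx => Real.logb_nonneg one_lt_two (by have := hγ k _ (hmem x hx); linarith))
    (AntitoneOn.antivaryOn (fun x _ y _ hxy => by gcongr) fun x hx y hy hxy =>
      Real.logb_le_logb_of_le one_lt_two (by have := hγ k _ (hmem x hx); linarith)
        (by have := hmono k r hr hx hy hxy; simpa using this))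
  refine (hprod.add (concaveOn_const_sub_mul (hR k) 0 α)).congr fun x _ => ?_
  simp only [Pi.add_apply, Pi.mul_apply, nfcpUtility, nfcUtility, downlinkBandwidth_update,
    Function.update_self]
  ring

theorem UtilitiesConcave.quasiconcave {R : Fin Ns → Set ℝ} {u : Fin Ns → (Fin Ns → ℝ) → ℝ}
    (h : UtilitiesConcave R u) : UtilitiesQuasiconcave R u := fun k r hr =>
  (h k r hr).quasiconcaveOn

end Model

/-! ### Continuity of the MMSE precoder and its SINR. -/

section Precoder

variable {Ns Nt : ℕ} {H Nq : Matrix (Fin Ns) (Fin Nt) ℂ} {N0 ψ : ℝ} {S : Set (Fin Ns → ℝ)}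

/-- Holds on the whole space, negative rates included, since `Real.sqrt` is continuous on all of
`ℝ`, being zero on negative arguments. -/
theorem continuous_quantizedChannel (H Nq : Matrix (Fin Ns) (Fin Nt) ℂ) :
    Continuous (quantizedChannel H Nq) := by
  have hpow : ∀ k : Fin Ns, Continuous fun r : Fin Ns → ℝ => (2 : ℝ) ^ (-r k) := fun k =>
    (Real.continuous_const_rpow two_ne_zero).comp (by fun_prop)
  refine continuous_matrix fun k j => ?_
  have h1 := Complex.continuous_ofReal.comp (Real.continuous_sqrt.comp
    (continuous_const.sub (hpow k) : Continuous fun r : Fin Ns → ℝ => 1 - (2 : ℝ) ^ (-r k)))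
  have h2 := Complex.continuous_ofReal.comp (Real.continuous_sqrt.comp (hpow k))
  exact (h1.mul continuous_const).add (h2.mul continuous_const)

theorem continuousOn_matrix_mul {X l m n : Type*} [TopologicalSpace X] [Fintype m] {S : Set X}
    {A : X → Matrix l m ℂ} {C : X → Matrix m n ℂ} (hA : ContinuousOn A S)
    (hC : ContinuousOn C S) : ContinuousOn (fun x => A x * C x) S := by
  rw [continuousOn_iff_continuous_domRestrict] at hA hC ⊢
  exact hA.matrix_mul hC

/-- The inverse is the adjugate over the determinant: polynomials in the entries, divided by a
nonvanishing one. -/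
theorem continuousOn_matrix_inv {X n : Type*} [TopologicalSpace X] [Fintype n] [DecidableEq n]
    {S : Set X} {A : X → Matrix n n ℂ} (hA : Continuous A) (h : ∀ x ∈ S, IsUnit (A x).det) :
    ContinuousOn (fun x => (A x)⁻¹) S := by
  have hdet : ContinuousOn (fun x => (A x).det⁻¹) S :=
    hA.matrix_det.continuousOn.inv₀ fun x hx => (h x hx).ne_zero
  refine (hdet.smul hA.matrix_adjugate.continuousOn).congr fun x _ => ?_
  rw [Matrix.inv_def, Ring.inverse_eq_inv']
  rfl

theorem continuousOn_unnormalizedPrecoder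
    (h : ∀ r ∈ S, IsUnit (regularizedGram ψ (quantizedChannel H Nq r)).det) :
    ContinuousOn (fun r => unnormalizedPrecoder ψ (quantizedChannel H Nq r)) S := by
  have hA := continuous_quantizedChannel H Nq
  have hG : Continuous fun r => regularizedGram ψ (quantizedChannel H Nq r) :=
    (hA.matrix_mul hA.matrix_conjTranspose).add continuous_const
  exact continuousOn_matrix_mul hA.matrix_conjTranspose.continuousOn
    (continuousOn_matrix_inv hG h)

theorem sum_norm_sq_pos_of_ne_zero {m n : Type*} [Fintype m] [Fintype n] {T : Matrix m n ℂ}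
    (hT : T ≠ 0) : 0 < ∑ j, ∑ i, ‖T j i‖ ^ 2 := by
  obtain ⟨j, i, hji⟩ : ∃ j i, T j i ≠ 0 := by
    by_contra! h
    exact hT (Matrix.ext h)
  refine Finset.sum_pos' (fun _ _ => Finset.sum_nonneg fun _ _ => sq_nonneg _)
    ⟨j, Finset.mem_univ _, Finset.sum_pos' (fun _ _ => sq_nonneg _) ⟨i, Finset.mem_univ _, ?_⟩⟩
  have := norm_pos_iff.2 hji
  positivity

theorem continuousOn_mmsePrecoder
    (h : ∀ r ∈ S, IsUnit (regularizedGram ψ (quantizedChannel H Nq r)).det ∧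
      unnormalizedPrecoder ψ (quantizedChannel H Nq r) ≠ 0) :
    ContinuousOn (fun r => mmsePrecoder ψ (quantizedChannel H Nq r)) S := by
  have hT := continuousOn_unnormalizedPrecoder fun r hr => (h r hr).1
  have hf : Continuous fun T : Matrix (Fin Nt) (Fin Ns) ℂ =>
      (Real.sqrt (∑ j, ∑ i, ‖T j i‖ ^ 2) : ℂ) := by fun_prop
  refine ContinuousOn.smul ((hf.comp_continuousOn hT).inv₀ fun r hr => ?_) hT
  exact Complex.ofReal_ne_zero.2 (Real.sqrt_pos.2 (sum_norm_sq_pos_of_ne_zero (h r hr).2)).ne'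

theorem sinr_nonneg (hN0 : 0 ≤ N0) (H : Matrix (Fin Ns) (Fin Nt) ℂ)
    (W : Matrix (Fin Nt) (Fin Ns) ℂ) (k : Fin Ns) : 0 ≤ sinr N0 H W k := by
  unfold sinr
  positivity

theorem continuous_sinr (hN0 : 0 < N0) (H : Matrix (Fin Ns) (Fin Nt) ℂ) (k : Fin Ns) :
    Continuous fun W : Matrix (Fin Nt) (Fin Ns) ℂ => sinr N0 H W k := by
  unfold sinr
  refine Continuous.div (by fun_prop) (by fun_prop) fun W => ?_
  positivity

end Precoder

end FeedbackGame

theorem theorem1 (Ns : ℕ) (B β : ℝ) :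
    -- existence under the two conditions, with and without pricing
    (∀ (γ : Fin Ns → (Fin Ns → ℝ) → ℝ) (R : Fin Ns → Set ℝ),
      (∀ α : ℝ, EquilibriumConditions R (nfcpUtility B β α γ) →
        ∃ r, IsNashEquilibrium R (nfcpUtility B β α γ) r) ∧
      (EquilibriumConditions R (nfcUtility B β γ) →
        ∃ r, IsNashEquilibrium R (nfcUtility B β γ) r)) ∧
    -- the two conditions hold in the model, by concavity of the utilities
    (∀ (γ : Fin Ns → (Fin Ns → ℝ) → ℝ) (rmax : Fin Ns → ℝ),
      (∀ k, 0 ≤ rmax k) → 0 ≤ β →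
      (∀ r ∈ strategySpace (rateInterval rmax), 0 ≤ downlinkBandwidth B β r) →
      (∀ k, ∀ r ∈ strategySpace (rateInterval rmax), 0 ≤ γ k r) →
      (∀ k, ContinuousOn (γ k) (strategySpace (rateInterval rmax))) →
      (∀ k, ∀ r ∈ strategySpace (rateInterval rmax),
        MonotoneOn (fun x => γ k (Function.update r k x)) (rateInterval rmax k)) →
      (∀ k, ∀ r ∈ strategySpace (rateInterval rmax),
        ConcaveOn ℝ (rateInterval rmax k)
          (fun x => Real.logb 2 (1 + γ k (Function.update r k x)))) →
      (∀ α : ℝ,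
        UtilitiesConcave (rateInterval rmax) (nfcpUtility B β α γ) ∧
        EquilibriumConditions (rateInterval rmax) (nfcpUtility B β α γ) ∧
        ∃ r, IsNashEquilibrium (rateInterval rmax) (nfcpUtility B β α γ) r) ∧
      (UtilitiesConcave (rateInterval rmax) (nfcUtility B β γ) ∧
        EquilibriumConditions (rateInterval rmax) (nfcUtility B β γ) ∧
        ∃ r, IsNashEquilibrium (rateInterval rmax) (nfcUtility B β γ) r)) ∧
    -- the SINR of the regularized (MMSE) precoder: all but quasi-concavity is automatic
    (∀ (Nt : ℕ) (H Nq : Matrix (Fin Ns) (Fin Nt) ℂ) (N0 ψ : ℝ) (rmax : Fin Ns → ℝ),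
      0 < N0 → (∀ k, 0 ≤ rmax k) →
      (∀ r ∈ strategySpace (rateInterval rmax),
        IsUnit (regularizedGram ψ (quantizedChannel H Nq r)).det ∧
        unnormalizedPrecoder ψ (quantizedChannel H Nq r) ≠ 0) →
      StrategySetsAdmissible (rateInterval rmax) ∧
      (∀ k, ∀ r ∈ strategySpace (rateInterval rmax), 0 ≤ mmseSinr N0 ψ H Nq k r) ∧
      (∀ k, ContinuousOn (mmseSinr N0 ψ H Nq k) (strategySpace (rateInterval rmax))) ∧
      (∀ α : ℝ,
        UtilitiesContinuous (rateInterval rmax) (nfcpUtility B β α (mmseSinr N0 ψ H Nq)) ∧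
        (UtilitiesQuasiconcave (rateInterval rmax) (nfcpUtility B β α (mmseSinr N0 ψ H Nq)) →
          ∃ r, IsNashEquilibrium (rateInterval rmax)
            (nfcpUtility B β α (mmseSinr N0 ψ H Nq)) r)) ∧
      UtilitiesContinuous (rateInterval rmax) (nfcUtility B β (mmseSinr N0 ψ H Nq)) ∧
      (UtilitiesQuasiconcave (rateInterval rmax) (nfcUtility B β (mmseSinr N0 ψ H Nq)) →
        ∃ r, IsNashEquilibrium (rateInterval rmax)
          (nfcUtility B β (mmseSinr N0 ψ H Nq)) r)) := by
  refine ⟨fun γ R => ⟨fun α h => exists_isNashEquilibrium h, fun h =>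
    exists_isNashEquilibrium h⟩, ?_, ?_⟩
  · intro γ rmax hr hβ hB hγ hc hmono hconc
    have main : ∀ α : ℝ,
        UtilitiesConcave (rateInterval rmax) (nfcpUtility B β α γ) ∧
        EquilibriumConditions (rateInterval rmax) (nfcpUtility B β α γ) ∧
        ∃ r, IsNashEquilibrium (rateInterval rmax) (nfcpUtility B β α γ) r := by
      intro α
      have h1 := utilitiesConcave_nfcpUtility (fun k => convex_Icc 0 (rmax k)) α hβ hB hγ hmono
        hconc
      have h2 : EquilibriumConditions (rateInterval rmax) (nfcpUtility B β α γ) :=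
        ⟨strategySetsAdmissible_rateInterval hr, utilitiesContinuous_nfcpUtility α hγ hc,
          h1.quasiconcave⟩
      exact ⟨h1, h2, exists_isNashEquilibrium h2⟩
    exact ⟨main, nfcpUtility_zero B β γ ▸ main 0⟩
  · intro Nt H Nq N0 ψ rmax hN0 hr hT
    have hR := strategySetsAdmissible_rateInterval hr
    have hγ : ∀ k, ∀ r ∈ strategySpace (rateInterval rmax), 0 ≤ mmseSinr N0 ψ H Nq k r :=
      fun k r _ => sinr_nonneg hN0.le _ _ _
    have hc : ∀ k, ContinuousOn (mmseSinr N0 ψ H Nq k) (strategySpace (rateInterval rmax)) :=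
      fun k => (continuous_sinr hN0 H k).comp_continuousOn (continuousOn_mmsePrecoder hT)
    have main : ∀ α : ℝ,
        UtilitiesContinuous (rateInterval rmax) (nfcpUtility B β α (mmseSinr N0 ψ H Nq)) ∧
        (UtilitiesQuasiconcave (rateInterval rmax) (nfcpUtility B β α (mmseSinr N0 ψ H Nq)) →
          ∃ r, IsNashEquilibrium (rateInterval rmax)
            (nfcpUtility B β α (mmseSinr N0 ψ H Nq)) r) := fun α =>
      have hu := utilitiesContinuous_nfcpUtility α hγ hc
      ⟨hu, fun hq => exists_isNashEquilibrium ⟨hR, hu, hq⟩⟩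
    exact ⟨hR, hγ, hc, main, nfcpUtility_zero B β (mmseSinr N0 ψ H Nq) ▸ main 0⟩
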